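/- **Theorem 4.2 (weighted John–Nirenberg inequality).** Let $n\ge 1$, $1<p<\infty$, $p'=p/(p-1)$ and $1\le r\le p'$. There is a constant $C_{n,p,r}\in(0,\infty)$, depending only on $n,p,r$, such that for every weight $w\in A^p(\mathbb R^n)$ and every (real- or complex-valued) $b\in \mathrm{BMO}_w(\mathbb R^n)$, $$\|b\|_{\mathrm{BMO}_w}\ \le\ \|b\|_{\mathrm{BMO}_{w,r}}\ \le\ C_{n,p,r}\,[w]_{A^p}^{\max\{1,\frac1{p-1}\}}\,\|b\|_{\mathrm{BMO}_w}.$$ In particular, $\|b\|_{\mathrm{BMO}_w}\approx\|b\|_{\mathrm{BMO}_{w,r}}$. Here suprema run over all cubes $Q\subset\mathbb R^n$ with sides parallel to the axes, $\langle f\rangle_Q=\frac1{|Q|}\int_Q f\,dx$ and $w(Q)=\int_Q w\,dx$. A weight $w$ belongs to $A^p(\mathbb R^n)$ if it is locally integrable, positive almost everywhere, and $$[w]_{A^p}:=\sup_Q\,\langle w\rangle_Q\,\big\langle w^{-\frac1{p-1}}\big\rangle_Q^{p-1}<\infty .$$ Moreover $$\|b\|_{\mathrm{BMO}_w}=\sup_Q\frac1{w(Q)}\int_Q|b-\langle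 b\rangle_Q|\,dx,\qquad \|b\|_{\mathrm{BMO}_{w,r}}=\Big(\sup_Q\frac1{w(Q)}\int_Q|b-\langle b\rangle_Q|^r\,w^{1-r}\,dx\Big)^{1/r},$$ and $\mathrm{BMO}_w(\mathbb R^n)$ is the set of $b\in L^1_{\mathrm{loc}}(\mathbb R^n)$ with $\|b\|_{\mathrm{BMO}_w}<\infty$. -/

import Mathlib

open MeasureTheory
open scoped ENNReal NNReal

namespace WeightedBMO

noncomputable section

/-- The axis-parallel cube in `ℝⁿ` with lower corner `a` and side length `l`.
It is used for `0 < l`. -/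
def cube {n : ℕ} (a : Fin n → ℝ) (l : ℝ) : Set (Fin n → ℝ) :=
  Set.Icc a (fun i => a i + l)

/-- The Muckenhoupt characteristic
`[w]_{A^p} = sup_Q ⟨w⟩_Q ⟨w^{-1/(p-1)}⟩_Q^{p-1}`, with values in `[0, ∞]`. -/
def apConst {n : ℕ} (p : ℝ) (w : (Fin n → ℝ) → ℝ) : ℝ≥0∞ :=
  ⨆ (a : Fin n → ℝ) (l : ℝ) (_ : 0 < l),
    (⨍⁻ x in cube a l, ENNReal.ofReal (w x) ∂volume) *
      (⨍⁻ x in cube a l, ENNReal.ofReal (w x) ^ (-(1 / (p - 1))) ∂volume) ^ (p - 1)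

/-- `w` is a Muckenhoupt `A^p(ℝⁿ)` weight: locally integrable, positive almost everywhere, with
finite characteristic. -/
structure IsApWeight {n : ℕ} (p : ℝ) (w : (Fin n → ℝ) → ℝ) : Prop where
  locallyIntegrable : LocallyIntegrable w
  pos : ∀ᵐ x, 0 < w x
  apConst_lt_top : apConst p w < ∞

/-- `w(Q) = ∫_Q w dx` for the cube `Q` with lower corner `a` and side length `l`. -/
def wMass {n : ℕ} (w : (Fin n → ℝ) → ℝ) (a : Fin n → ℝ) (l : ℝ) : ℝ≥0∞ :=
  ∫⁻ x in cube a l, ENNReal.ofReal (w x)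

/-- `‖b‖_{BMO_w} = sup_Q w(Q)⁻¹ ∫_Q |b - ⟨b⟩_Q| dx`, with values in `[0, ∞]`. -/
def bmoNorm {n : ℕ} (w : (Fin n → ℝ) → ℝ) (b : (Fin n → ℝ) → ℂ) : ℝ≥0∞ :=
  ⨆ (a : Fin n → ℝ) (l : ℝ) (_ : 0 < l),
    (∫⁻ x in cube a l, ‖b x - ⨍ y in cube a l, b y‖ₑ) / wMass w a l

/-- `‖b‖_{BMO_{w,r}} = (sup_Q w(Q)⁻¹ ∫_Q |b - ⟨b⟩_Q|^r w^{1-r} dx)^{1/r}`,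
with values in `[0, ∞]`. -/
def bmoNormR {n : ℕ} (w : (Fin n → ℝ) → ℝ) (r : ℝ) (b : (Fin n → ℝ) → ℂ) : ℝ≥0∞ :=
  (⨆ (a : Fin n → ℝ) (l : ℝ) (_ : 0 < l),
    (∫⁻ x in cube a l,
      ‖b x - ⨍ y in cube a l, b y‖ₑ ^ r * ENNReal.ofReal (w x) ^ (1 - r)) / wMass w a l)
    ^ (1 / r)

/-- `b` belongs to `BMO_w(ℝⁿ)`: it is locally integrable with finite `BMO_w` norm. -/
structure MemBMO {n : ℕ} (w : (Fin n → ℝ) → ℝ) (b : (Fin n → ℝ) → ℂ) : Prop where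
  locallyIntegrable : LocallyIntegrable b
  bmoNorm_lt_top : bmoNorm w b < ∞

end

end WeightedBMO

open MeasureTheory
open scoped ENNReal NNReal

namespace WeightedBMO

/-! For `r = p'` the factor `w ^ (1 - r)` is the dual weight `σ = w ^ (-1/(p-1))`. Fix a cube `Q`
and its dyadic subcubes. A stopping-time argument bounds `|b - ⟨b⟩_Q|` by `2 * 2 ^ n` times the sum
of the oscillations of `b` over the selected cubes `P ∋ x` (`enorm_mean_sub_mean_zero_le`). These
cubes are sparse: each has a part of at least half its measure that meets no later selected cube
(`measure_cell_le_two_mul`). The oscillation on `P` is at most `‖b‖ ⟨w⟩_P`, so it remains to bound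
`∑ ⟨w⟩_P 1_P` in `L^{p'}(σ)` by `w(Q) ^ (1/p')`.

That bound (`lintegral_sparse_rpow_le`) needs no maximal theorem: `F ^ q` is telescoped into terms
`⟨w⟩_P F_P ^ (q-1)` with `F_P` constant on `P`. The product `⟨w⟩_P σ(P)` is controlled by an
integral of `σ ^ (1/p) w ^ (1/q)` over the private part of `P`, with the sharp power of the
characteristic (`laverage_mul_lintegral_dual_le`). The private parts are disjoint, so Hölder's
inequality and absorption finish.

Fatou's lemma passes from dyadic means to `b`. The other exponents follow from Jensen's inequality
for `|b - ⟨b⟩_Q| / w` against `w dx`. -/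

/-- A sequence of successively finer measurable partitions of `X`, the `k`-th of which is given by
the fibres of `idx k`. -/
structure NestedPartition (X ι : Type*) [MeasurableSpace X] where
  idx : ℕ → X → ι
  measurableSet_fiber : ∀ k m, MeasurableSet (idx k ⁻¹' {m})
  nested : ∀ k x y, idx (k + 1) x = idx (k + 1) y → idx k x = idx k y

/-! ### Nested partitions and their maximal function. -/

namespace NestedPartition

variable {X ι : Type*} [MeasurableSpace X] (D : NestedPartition X ι)

/-- The cell of the `k`-th partition that contains `x`. -/
def cell (k : ℕ) (x : X) : Set X := D.idx k ⁻¹' {D.idx k x}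

/-- `h` is constant on the cells of the `k`-th partition. -/
def IsLevel {β : Type*} (k : ℕ) (h : X → β) : Prop :=
  ∀ x y, D.idx k x = D.idx k y → h x = h y

lemma mem_cell_iff {k : ℕ} {x y : X} : y ∈ D.cell k x ↔ D.idx k y = D.idx k x := Iff.rfl

lemma mem_cell_self (k : ℕ) (x : X) : x ∈ D.cell k x := rfl

lemma measurableSet_cell (k : ℕ) (x : X) : MeasurableSet (D.cell k x) :=
  D.measurableSet_fiber _ _

lemma idx_eq_of_le {j k : ℕ} (hjk : j ≤ k) {x y : X} (h : D.idx k x = D.idx k y) :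
    D.idx j x = D.idx j y := by
  induction k, hjk using Nat.le_induction with
  | base => exact h
  | succ k _ ih => exact ih (D.nested _ _ _ h)

lemma cell_eq {k : ℕ} {x y : X} (h : D.idx k x = D.idx k y) : D.cell k x = D.cell k y := by
  simp only [cell, h]

lemma cell_eq_of_mem {k : ℕ} {x y : X} (h : y ∈ D.cell k x) : D.cell k y = D.cell k x :=
  D.cell_eq h

lemma cell_subset_of_le {j k : ℕ} (hjk : j ≤ k) (x : X) : D.cell k x ⊆ D.cell j x :=
  fun _ hy => D.idx_eq_of_le hjk hy

lemma cell_subset_of_mem {j k : ℕ} (hjk : j ≤ k) {x y : X} (hy : y ∈ D.cell j x) :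
    D.cell k y ⊆ D.cell j x :=
  (D.cell_subset_of_le hjk y).trans (D.cell_eq_of_mem hy).subset

lemma IsLevel.mono {D : NestedPartition X ι} {β : Type*} {j k : ℕ} (hjk : j ≤ k) {h : X → β}
    (hh : D.IsLevel j h) : D.IsLevel k h :=
  fun _ _ hxy => hh _ _ (D.idx_eq_of_le hjk hxy)

lemma isLevel_of_cell {β : Type*} (k : ℕ) (h : Set X → β) :
    D.IsLevel k fun x => h (D.cell k x) :=
  fun _ _ hxy => congrArg h (D.cell_eq hxy)

/-- Every preimage is a union of fibres, of which there are countably many. -/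
lemma IsLevel.measurable [Countable ι] {D : NestedPartition X ι} {β : Type*} [MeasurableSpace β]
    {k : ℕ} {h : X → β} (hh : D.IsLevel k h) : Measurable h := by
  intro s _
  have : h ⁻¹' s = ⋃ m ∈ D.idx k '' (h ⁻¹' s), D.idx k ⁻¹' {m} := by
    ext x
    simp only [Set.mem_iUnion, Set.mem_image, Set.mem_preimage, Set.mem_singleton_iff, exists_prop]
    constructor
    · intro hx
      exact ⟨_, ⟨x, hx, rfl⟩, rfl⟩
    · rintro ⟨_, ⟨y, hy, rfl⟩, hxy⟩
      rwa [hh x y hxy]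
  rw [this]
  exact MeasurableSet.biUnion (Set.to_countable _) fun m _ => D.measurableSet_fiber k m

lemma IsLevel.measurableSet [Countable ι] {D : NestedPartition X ι} {k : ℕ} {p : X → Prop}
    (hp : D.IsLevel k p) : MeasurableSet {x | p x} :=
  measurableSet_setOfPred.2 hp.measurable

/-- An inequality between integrals may be checked on the cells of a partition. -/
lemma setLIntegral_le_of_forall_cell [Countable ι] {μ : Measure X} {j k : ℕ} (hjk : j ≤ k) (x : X)
    {f g : X → ℝ≥0∞}
    (h : ∀ y ∈ D.cell j x, ∫⁻ z in D.cell k y, f z ∂μ ≤ ∫⁻ z in D.cell k y, g z ∂μ) :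
    ∫⁻ z in D.cell j x, f z ∂μ ≤ ∫⁻ z in D.cell j x, g z ∂μ := by
  have hU : D.cell j x = ⋃ m, D.idx k ⁻¹' {m} ∩ D.cell j x := by
    ext y; simp
  have hm : ∀ m, MeasurableSet (D.idx k ⁻¹' {m} ∩ D.cell j x) := fun m =>
    (D.measurableSet_fiber k m).inter (D.measurableSet_cell j x)
  have hd : Pairwise (Function.onFun Disjoint fun m => D.idx k ⁻¹' {m} ∩ D.cell j x) := by
    intro m m' hne
    refine Set.disjoint_left.2 ?_
    rintro y ⟨rfl, _⟩ ⟨h2, _⟩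
    exact hne h2
  rw [hU, lintegral_iUnion hm hd, lintegral_iUnion hm hd]
  refine ENNReal.tsum_le_tsum fun m => ?_
  rcases (D.idx k ⁻¹' {m} ∩ D.cell j x).eq_empty_or_nonempty with he | ⟨y, rfl, hy⟩
  · simp [he]
  · have : D.idx k ⁻¹' {D.idx k y} ∩ D.cell j x = D.cell k y :=
      Set.inter_eq_left.2 (D.cell_subset_of_mem hjk hy)
    rw [this]
    exact h y hy

/-- The weak type `(1, 1)` inequality for the maximal function of a nested partition. -/
lemma mul_measure_lt_average_le [Countable ι] {μ : Measure X}
    (k : ℕ) (x : X) (f : X → ℝ≥0∞) (t : ℝ≥0∞) :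
    t * μ {y ∈ D.cell k x | ∃ j, k ≤ j ∧ t < ⨍⁻ z in D.cell j y, f z ∂μ} ≤
      ∫⁻ z in D.cell k x, f z ∂μ := by
  classical
  let A : ℕ → X → Prop := fun j y => k ≤ j ∧ t < ⨍⁻ z in D.cell j y, f z ∂μ
  -- Points whose first level with average above `t` is `j`: a disjoint family, each member a union
  -- of cells of level `j`.
  let V : ℕ → Set X := fun j => {y | y ∈ D.cell k x ∧ A j y ∧ ∀ i < j, ¬ A i y}
  have hA : ∀ j, D.IsLevel j (A j) := fun j =>
    D.isLevel_of_cell j fun s => k ≤ j ∧ t < ⨍⁻ z in s, f z ∂μ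
  have hVlevel : ∀ j, k ≤ j → D.IsLevel j (· ∈ V j) := by
    intro j hj y z hyz
    have h1 : (y ∈ D.cell k x) = (z ∈ D.cell k x) := by
      simp only [mem_cell_iff, D.idx_eq_of_le hj hyz]
    have h2 : (∀ i < j, ¬ A i y) = (∀ i < j, ¬ A i z) := by
      refine forall_congr fun i => forall_congr fun hi => ?_
      rw [(hA i).mono hi.le y z hyz]
    simp only [V, Set.mem_ofPred_eq, h1, h2, hA j y z hyz]
  have hVempty : ∀ j, ¬ k ≤ j → V j = ∅ := by
    intro j hj
    refine Set.eq_empty_of_forall_notMem ?_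
    rintro y ⟨_, ⟨h, _⟩, _⟩
    exact hj h
  have hVm : ∀ j, MeasurableSet (V j) := by
    intro j
    by_cases hj : k ≤ j
    · exact (hVlevel j hj).measurableSet
    · rw [hVempty j hj]; exact MeasurableSet.empty
  have hVd : Pairwise (Function.onFun Disjoint V) := by
    intro i j hij
    refine Set.disjoint_left.2 ?_
    rintro y ⟨_, h1, h2⟩ ⟨_, h3, h4⟩
    rcases lt_or_gt_of_ne hij with h | h
    · exact h4 i h h1
    · exact h2 j h h3
  have hU : {y ∈ D.cell k x | ∃ j, k ≤ j ∧ t < ⨍⁻ z in D.cell j y, f z ∂μ} = ⋃ j, V j := by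
    ext y
    simp only [Set.mem_ofPred_eq, Set.mem_iUnion]
    constructor
    · rintro ⟨hy, hex⟩
      exact ⟨Nat.find hex, hy, Nat.find_spec hex, fun i hi => Nat.find_min hex hi⟩
    · rintro ⟨j, hy, hj, _⟩
      exact ⟨hy, j, hj⟩
  have hVsub : ∀ j, V j ⊆ D.cell k x := fun j y hy => hy.1
  have hle : ∀ j, t * μ (V j) ≤ ∫⁻ z in V j, f z ∂μ := by
    intro j
    by_cases hj : k ≤ j
    · have key : ∫⁻ z in D.cell k x, (V j).indicator (fun _ => t) z ∂μ ≤
          ∫⁻ z in D.cell k x, (V j).indicator f z ∂μ := by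
        refine D.setLIntegral_le_of_forall_cell hj x fun y _ => ?_
        rw [setLIntegral_indicator (hVm j), setLIntegral_indicator (hVm j)]
        by_cases hy : y ∈ V j
        · have hsub : V j ∩ D.cell j y = D.cell j y :=
            Set.inter_eq_right.2 fun z hz => (hVlevel j hj z y hz).mpr hy
          rw [hsub, setLIntegral_const]
          refine (mul_le_mul_left hy.2.1.2.le _).trans ?_
          rw [setLAverage_eq]
          exact ENNReal.mul_le_of_le_div le_rfl
        · have hsub : V j ∩ D.cell j y = ∅ :=
            Set.eq_empty_of_forall_notMem fun z hz => hy ((hVlevel j hj z y hz.2).mp hz.1)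
          simp [hsub]
      rwa [setLIntegral_indicator (hVm j), setLIntegral_indicator (hVm j),
        Set.inter_eq_left.2 (hVsub j), setLIntegral_const] at key
    · simp [hVempty j hj]
  rw [hU, measure_iUnion hVd hVm, ← ENNReal.tsum_mul_left]
  calc ∑' j, t * μ (V j) ≤ ∑' j, ∫⁻ z in V j, f z ∂μ := ENNReal.tsum_le_tsum hle
    _ = ∫⁻ z in ⋃ j, V j, f z ∂μ := (lintegral_iUnion hVm hVd _).symm
    _ ≤ _ := lintegral_mono_set (Set.iUnion_subset hVsub)

/-! ### Stopping levels and sparse domination of the oscillation. -/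

section Stopping

variable (μ : Measure X) (b : X → ℂ)

/-- The average of `b` on the cell of level `k` that contains `x`. -/
noncomputable def mean (k : ℕ) (x : X) : ℂ := ⨍ z in D.cell k x, b z ∂μ

/-- The average on the cell of level `k` of the deviation of `b` from its mean on the cell of
level `j`. -/
noncomputable def dev (j k : ℕ) (x : X) : ℝ≥0∞ :=
  ⨍⁻ z in D.cell k x, ‖b z - D.mean μ b j x‖ₑ ∂μ

open Classical in
/-- The last level up to `k` at which the oscillation of `b` around `x` was reset: a new level is
selected when the average deviation from the mean on the last selected cell exceeds twice the
oscillation of `b` on that cell. -/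
noncomputable def lastStop : ℕ → X → ℕ
  | 0, _ => 0
  | k + 1, x =>
    if 2 * D.dev μ b (lastStop k x) (lastStop k x) x < D.dev μ b (lastStop k x) (k + 1) x
    then k + 1 else lastStop k x

lemma lastStop_le (k : ℕ) (x : X) : D.lastStop μ b k x ≤ k := by
  induction k with
  | zero => rfl
  | succ k ih =>
    rw [lastStop]
    split_ifs <;> omega

lemma isLevel_mean (k : ℕ) : D.IsLevel k (D.mean μ b k) :=
  D.isLevel_of_cell k fun s => ⨍ z in s, b z ∂μ

lemma dev_congr {j k l : ℕ} (hj : j ≤ l) (hk : k ≤ l) {x y : X} (h : D.idx l x = D.idx l y) :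
    D.dev μ b j k x = D.dev μ b j k y := by
  rw [dev, dev, (D.isLevel_mean μ b j).mono hj x y h, D.cell_eq (D.idx_eq_of_le hk h)]

lemma isLevel_lastStop (k : ℕ) : D.IsLevel k (D.lastStop μ b k) := by
  induction k with
  | zero => exact fun _ _ _ => rfl
  | succ k ih =>
    intro x y hxy
    have hle := (D.lastStop_le μ b k y).trans k.le_succ
    rw [lastStop, lastStop, ih x y (D.nested _ _ _ hxy), D.dev_congr μ b hle hle hxy,
      D.dev_congr μ b hle le_rfl hxy]

/-- Either level `k` was just selected, and the bound is `t ≤ 2 * t`, or the selection criterion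
failed at `k`. -/
lemma dev_lastStop_le (k : ℕ) (x : X) :
    D.dev μ b (D.lastStop μ b k x) k x ≤
      2 * D.dev μ b (D.lastStop μ b k x) (D.lastStop μ b k x) x := by
  have h2 : ∀ t : ℝ≥0∞, t ≤ 2 * t := fun t => le_mul_of_one_le_left' one_le_two
  cases k with
  | zero => exact h2 _
  | succ k =>
    by_cases h : 2 * D.dev μ b (D.lastStop μ b k x) (D.lastStop μ b k x) x <
        D.dev μ b (D.lastStop μ b k x) (k + 1) x
    · have : D.lastStop μ b (k + 1) x = k + 1 := by rw [lastStop, if_pos h]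
      rw [this]
      exact h2 _
    · have : D.lastStop μ b (k + 1) x = D.lastStop μ b k x := by rw [lastStop, if_neg h]
      rw [this]
      exact not_lt.1 h

variable {μ b}

lemma enorm_mean_sub_le {k : ℕ} {x : X} (h0 : μ (D.cell k x) ≠ 0) (htop : μ (D.cell k x) ≠ ∞)
    (hb : IntegrableOn b (D.cell k x) μ) (c : ℂ) :
    ‖D.mean μ b k x - c‖ₑ ≤ ⨍⁻ z in D.cell k x, ‖b z - c‖ₑ ∂μ := by
  have : Fact (μ (D.cell k x) < ∞) := ⟨htop.lt_top⟩
  have hc : D.mean μ b k x - c = ⨍ z in D.cell k x, (b z - c) ∂μ := by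
    have h1 : ⨍ _z in D.cell k x, c ∂μ = c := setAverage_const h0 htop c
    rw [mean]
    conv_lhs => rw [← h1]
    simp only [average]
    rw [integral_sub]
    · exact (hb.integrable).smul_measure (ENNReal.inv_ne_top.2 (by simpa using h0))
    · exact (integrable_const c).smul_measure (ENNReal.inv_ne_top.2 (by simpa using h0))
  rw [hc]
  exact enorm_integral_le_lintegral_enorm _

/-- Limits the overshoot at a newly selected cell: its parent still satisfied the bound by twice the
oscillation, and passing to the child costs a factor `d`. -/
lemma laverage_succ_le {d : ℝ≥0∞} {k : ℕ} {x : X}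
    (h0 : μ (D.cell k x) ≠ 0) (htop : μ (D.cell k x) ≠ ∞)
    (hd : μ (D.cell k x) ≤ d * μ (D.cell (k + 1) x)) (hd' : d ≠ ∞)
    (f : X → ℝ≥0∞) :
    ⨍⁻ z in D.cell (k + 1) x, f z ∂μ ≤ d * ⨍⁻ z in D.cell k x, f z ∂μ := by
  have hsub := D.cell_subset_of_le k.le_succ x
  have hd0 : d ≠ 0 := by rintro rfl; simp at hd; exact h0 hd
  rw [setLAverage_eq, setLAverage_eq, ← mul_div_assoc]
  refine ENNReal.div_le_of_le_mul ?_
  calc ∫⁻ z in D.cell (k + 1) x, f z ∂μ ≤ ∫⁻ z in D.cell k x, f z ∂μ := lintegral_mono_set hsub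
    _ = (∫⁻ z in D.cell k x, f z ∂μ) / μ (D.cell k x) * μ (D.cell k x) :=
      (ENNReal.div_mul_cancel h0 htop).symm
    _ ≤ (∫⁻ z in D.cell k x, f z ∂μ) / μ (D.cell k x) * (d * μ (D.cell (k + 1) x)) := by gcongr
    _ = _ := by simp only [div_eq_mul_inv]; ring

/-- The pointwise sparse bound for the martingale of averages of `b`. -/
lemma enorm_mean_sub_mean_zero_le {d : ℝ≥0∞} (hd1 : 1 ≤ d) (hd' : d ≠ ∞)
    (h0 : ∀ k x, μ (D.cell k x) ≠ 0) (htop : ∀ k x, μ (D.cell k x) ≠ ∞)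
    (hd : ∀ k x, μ (D.cell k x) ≤ d * μ (D.cell (k + 1) x))
    (hb : ∀ k x, IntegrableOn b (D.cell k x) μ) (k : ℕ) (x : X) :
    ‖D.mean μ b k x - D.mean μ b 0 x‖ₑ ≤
      2 * d * ∑ j ∈ Finset.range (k + 1),
        {y | D.lastStop μ b j y = j}.indicator (fun y => D.dev μ b j j y) x := by
  -- The extra term on the left makes the induction work: it is the reserve that pays for the jump
  -- of the mean to the next selected level.
  have hstep : ∀ k, ‖D.mean μ b (D.lastStop μ b k x) x - D.mean μ b 0 x‖ₑ +
      2 * d * D.dev μ b (D.lastStop μ b k x) (D.lastStop μ b k x) x ≤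
      2 * d * ∑ j ∈ Finset.range (k + 1),
        {y | D.lastStop μ b j y = j}.indicator (fun y => D.dev μ b j j y) x := by
    intro k
    induction k with
    | zero => simp [lastStop]
    | succ k ih =>
      rw [Finset.sum_range_succ]
      by_cases h : 2 * D.dev μ b (D.lastStop μ b k x) (D.lastStop μ b k x) x <
        D.dev μ b (D.lastStop μ b k x) (k + 1) x
      · have hk : D.lastStop μ b (k + 1) x = k + 1 := by rw [lastStop, if_pos h]
        have hmem : x ∈ {y | D.lastStop μ b (k + 1) y = k + 1} := hk
        rw [hk, Set.indicator_of_mem hmem, mul_add]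
        gcongr
        refine le_trans ?_ ih
        set t := D.lastStop μ b k x with ht
        have h1 : ‖D.mean μ b (k + 1) x - D.mean μ b t x‖ₑ ≤ 2 * d * D.dev μ b t t x :=
          calc _ ≤ D.dev μ b t (k + 1) x :=
                D.enorm_mean_sub_le (h0 _ _) (htop _ _) (hb _ _) _
            _ ≤ d * D.dev μ b t k x :=
                D.laverage_succ_le (h0 _ _) (htop _ _) (hd _ _) hd' _
            _ ≤ d * (2 * D.dev μ b t t x) := by
                gcongr
                exact D.dev_lastStop_le μ b k x
            _ = _ := by ring
        calc _ = ‖(D.mean μ b t x - D.mean μ b 0 x) +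
              (D.mean μ b (k + 1) x - D.mean μ b t x)‖ₑ := by congr 1; ring
          _ ≤ _ := (enorm_add_le _ _).trans (by gcongr)
      · have : D.lastStop μ b (k + 1) x = D.lastStop μ b k x := by rw [lastStop, if_neg h]
        rw [this, mul_add]
        exact ih.trans le_self_add
  refine le_trans ?_ (hstep k)
  set t := D.lastStop μ b k x with ht
  have h1 : ‖D.mean μ b k x - D.mean μ b t x‖ₑ ≤ 2 * d * D.dev μ b t t x :=
    calc _ ≤ D.dev μ b t k x := D.enorm_mean_sub_le (h0 _ _) (htop _ _) (hb _ _) _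
      _ ≤ 2 * D.dev μ b t t x := D.dev_lastStop_le μ b k x
      _ ≤ 2 * d * D.dev μ b t t x := by
        gcongr
        exact le_mul_of_one_le_right' hd1
  calc _ = ‖(D.mean μ b t x - D.mean μ b 0 x) + (D.mean μ b k x - D.mean μ b t x)‖ₑ := by
        congr 1; ring
    _ ≤ _ := (enorm_add_le _ _).trans (by gcongr)

/-- The first selection after level `k` is tested against level `k` itself; if that test never
succeeded, `lastStop` would stay at `k` forever. -/
lemma exists_lt_dev_of_lastStop_eq {k j : ℕ} {y : X} (hk : D.lastStop μ b k y = k) (hkj : k < j)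
    (hj : D.lastStop μ b j y = j) :
    ∃ i, k ≤ i ∧ 2 * D.dev μ b k k y < D.dev μ b k i y := by
  by_contra! hcon
  have : ∀ i, k ≤ i → D.lastStop μ b i y = k := by
    intro i hi
    induction i, hi using Nat.le_induction with
    | base => exact hk
    | succ i hi ih => rw [lastStop, ih, if_neg (not_lt.2 (hcon _ (by omega)))]
  have := this j hkj.le
  omega

/-- The cells selected by `lastStop` form a sparse family. -/
lemma measure_cell_le_two_mul [Countable ι] (h0 : ∀ k x, μ (D.cell k x) ≠ 0)
    (htop : ∀ k x, μ (D.cell k x) ≠ ∞) (hb : ∀ k x, IntegrableOn b (D.cell k x) μ)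
    {k : ℕ} {x : X} (hx : D.lastStop μ b k x = k) :
    μ (D.cell k x) ≤ 2 * μ (D.cell k x ∩
      ({y | D.lastStop μ b k y = k} \ ⋃ j > k, {y | D.lastStop μ b j y = j})) := by
  set E := {y | D.lastStop μ b k y = k} \ ⋃ j > k, {y | D.lastStop μ b j y = j} with hE
  set f : X → ℝ≥0∞ := fun z => ‖b z - D.mean μ b k x‖ₑ with hf
  set ρ : ℝ≥0∞ := ⨍⁻ z in D.cell k x, f z ∂μ with hρ
  -- Points of the cell outside `E` are selected again later, hence lie in this superlevel set at
  -- twice the average `ρ`, whose measure the weak type bound limits to half the cell.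
  set V := {y ∈ D.cell k x | ∃ j, k ≤ j ∧ 2 * ρ < ⨍⁻ z in D.cell j y, f z ∂μ} with hV
  have hsub : D.cell k x ⊆ (D.cell k x ∩ E) ∪ V := by
    intro y hy
    by_cases hyE : y ∈ E
    · exact Or.inl ⟨hy, hyE⟩
    have hky : D.lastStop μ b k y = k := by rw [D.isLevel_lastStop μ b k y x hy, hx]
    simp only [hE, Set.mem_sdiff, Set.mem_ofPred_eq, hky, true_and, not_not, Set.mem_iUnion,
      exists_prop] at hyE
    obtain ⟨j, hj, hjy⟩ := hyE
    obtain ⟨i, hi, hlt⟩ := D.exists_lt_dev_of_lastStop_eq hky hj hjy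
    rw [D.dev_congr μ b le_rfl le_rfl hy] at hlt
    refine Or.inr ⟨hy, i, hi, ?_⟩
    rwa [dev, dev, D.isLevel_mean μ b k y x hy] at hlt
  have hint : ∫⁻ z in D.cell k x, f z ∂μ = ρ * μ (D.cell k x) := by
    rw [hρ, setLAverage_eq, ENNReal.div_mul_cancel (h0 _ _) (htop _ _)]
  have hfin : ∫⁻ z in D.cell k x, f z ∂μ ≠ ∞ := by
    have hi : IntegrableOn (fun z => b z - D.mean μ b k x) (D.cell k x) μ :=
      (hb k x).sub (integrableOn_const (htop k x))
    exact hi.2.ne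
  have hρtop : ρ ≠ ∞ := (setLAverage_lt_top hfin).ne
  have hVle : 2 * μ V ≤ μ (D.cell k x) := by
    -- The weak type bound must be divided by `ρ`. If `ρ = 0`, all averages on subcells vanish and
    -- `V` is empty.
    by_cases hρ0 : ρ = 0
    · have : V = ∅ := by
        refine Set.eq_empty_of_forall_notMem ?_
        rintro y ⟨hy, j, hj, hlt⟩
        refine absurd hlt (not_lt.2 ?_)
        have : ∫⁻ z in D.cell j y, f z ∂μ ≤ 0 := by
          refine (lintegral_mono_set (D.cell_subset_of_mem hj hy)).trans ?_
          rw [hint, hρ0, zero_mul]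
        rw [setLAverage_eq, nonpos_iff_eq_zero.1 this]
        simp
      simp [this]
    · have := D.mul_measure_lt_average_le (μ := μ) k x f (2 * ρ)
      rw [hint, mul_comm 2 ρ, mul_assoc] at this
      rw [mul_comm ρ 2] at this
      exact (ENNReal.mul_le_mul_iff_right hρ0 hρtop).1 this
  have h1 : μ (D.cell k x) ≤ μ (D.cell k x ∩ E) + μ V :=
    (measure_mono hsub).trans (measure_union_le _ _)
  have h2 : μ (D.cell k x) + μ (D.cell k x) ≤ 2 * μ (D.cell k x ∩ E) + μ (D.cell k x) :=
    calc _ = 2 * μ (D.cell k x) := (two_mul _).symm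
      _ ≤ 2 * (μ (D.cell k x ∩ E) + μ V) := by gcongr
      _ = 2 * μ (D.cell k x ∩ E) + 2 * μ V := mul_add _ _ _
      _ ≤ _ := by gcongr
  exact (ENNReal.add_le_add_iff_right (htop k x)).1 h2

end Stopping

end NestedPartition

/-! ### Elementary power inequalities. -/

/-- Convexity of `t ^ q`: Bernoulli's inequality at `-a / (x + a)`, multiplied by `(x + a) ^ q`. -/
lemma add_rpow_le {q : ℝ} (hq : 1 < q) (x a : ℝ≥0∞) :
    (x + a) ^ q ≤ x ^ q + ENNReal.ofReal q * (a * (x + a) ^ (q - 1)) := by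
  have hq0 : 0 < q := by linarith
  have hq1 : 0 < q - 1 := by linarith
  by_cases hx : x = ∞
  · simp [hx, ENNReal.top_rpow_of_pos hq0]
  by_cases ha : a = ∞
  · simp [ha, ENNReal.top_rpow_of_pos hq0, ENNReal.top_rpow_of_pos hq1, ENNReal.mul_top, hq0]
  by_cases hxa : x + a = 0
  · simp [hxa, ENNReal.zero_rpow_of_pos hq0]
  lift x to ℝ≥0 using hx
  lift a to ℝ≥0 using ha
  have hy : (0 : ℝ) < x + a := by
    have : x + a ≠ 0 := by exact_mod_cast hxa
    exact_mod_cast pos_iff_ne_zero.2 this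
  have hreal : ((x : ℝ) + a) ^ q ≤ (x : ℝ) ^ q + q * (a * ((x : ℝ) + a) ^ (q - 1)) := by
    have hs : (-1 : ℝ) ≤ -(a / (x + a)) := by
      rw [neg_le_neg_iff, div_le_one hy]
      exact le_add_of_nonneg_left x.2
    have hB := one_add_mul_self_le_rpow_one_add hs hq.le
    have hxe : (1 : ℝ) + -(a / (x + a)) = x / (x + a) := by field_simp; ring
    rw [hxe, Real.div_rpow (NNReal.coe_nonneg x) hy.le,
      le_div_iff₀ (Real.rpow_pos_of_pos hy q)] at hB
    have hsplit : ((x : ℝ) + a) ^ q = (x + a) * ((x : ℝ) + a) ^ (q - 1) := by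
      rw [← Real.rpow_one_add' hy.le (by linarith)]
      congr 1; ring
    have hE : (1 + q * -((a : ℝ) / (x + a))) * ((x : ℝ) + a) ^ q =
        ((x : ℝ) + a) ^ q - q * (a * ((x : ℝ) + a) ^ (q - 1)) := by
      rw [hsplit]; field_simp; ring
    linarith
  have hnn : (x + a) ^ q ≤ x ^ q + q.toNNReal * (a * (x + a) ^ (q - 1)) := by
    rw [← NNReal.coe_le_coe]
    push_cast
    rwa [Real.coe_toNNReal q hq0.le]
  rw [ENNReal.ofReal, ← ENNReal.coe_add, ← ENNReal.coe_rpow_of_nonneg _ hq0.le,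
    ← ENNReal.coe_rpow_of_nonneg _ hq1.le, ← ENNReal.coe_rpow_of_nonneg _ hq0.le]
  exact_mod_cast hnn

/-- Telescoping of the powers of the partial sums, a discrete form of `F ^ q = q ∫ F ^ (q-1) dF`.
Each term involves only the sum up to its own index. -/
lemma sum_range_rpow_le {q : ℝ} (hq : 1 < q) (a : ℕ → ℝ≥0∞) (N : ℕ) :
    (∑ k ∈ Finset.range N, a k) ^ q ≤ ENNReal.ofReal q *
      ∑ k ∈ Finset.range N, a k * (∑ j ∈ Finset.range (k + 1), a j) ^ (q - 1) := by
  induction N with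
  | zero => simp [ENNReal.zero_rpow_of_pos (zero_lt_one.trans hq)]
  | succ N ih =>
    rw [Finset.sum_range_succ _ N, Finset.sum_range_succ _ N, mul_add]
    refine (add_rpow_le hq _ _).trans ?_
    rw [Finset.sum_range_succ a N]
    gcongr

/-- Absorption: `I ^ (1/p)` is cancelled from both sides, which requires `I` finite. -/
lemma le_rpow_of_le_mul_rpow {p q : ℝ} (hpq : p.HolderConjugate q) {I c : ℝ≥0∞} (hI : I ≠ ∞)
    (h : I ≤ c * I ^ (1 / p)) : I ≤ c ^ q := by
  by_cases h0 : I = 0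
  · simp [h0]
  have hsplit : I ^ (1 / q) * I ^ (1 / p) = I := by
    rw [← ENNReal.rpow_add _ _ h0 hI, one_div, one_div, add_comm, hpq.inv_add_inv_eq_one,
      ENNReal.rpow_one]
  have h2 : I ^ (1 / q) * I ^ (1 / p) ≤ c * I ^ (1 / p) := hsplit.le.trans h
  have h3 := (ENNReal.mul_le_mul_iff_left (by simp [ENNReal.rpow_eq_zero_iff, h0, hI])
    (ENNReal.rpow_ne_top_of_nonneg hpq.one_div_pos.le hI)).1 h2
  calc I = (I ^ (1 / q)) ^ q := by
        rw [← ENNReal.rpow_mul, one_div_mul_cancel hpq.symm.ne_zero, ENNReal.rpow_one]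
    _ ≤ c ^ q := ENNReal.rpow_le_rpow h3 hpq.symm.nonneg

/-! ### The `A^p` condition on sparse pieces. -/

/-- Hölder's inequality in the form `|E|^{1+s} ≤ (∫_E u)^s ∫_E u^{-s}`. -/
lemma measure_rpow_le_lintegral_rpow_mul {X : Type*} [MeasurableSpace X] {ν : Measure X}
    {u : X → ℝ≥0∞} (hu : AEMeasurable u ν) (h0 : ∀ᵐ x ∂ν, u x ≠ 0) (htop : ∀ᵐ x ∂ν, u x ≠ ∞)
    {s : ℝ} (hs : 0 ≤ s) :
    ν Set.univ ^ (1 + s) ≤ (∫⁻ x, u x ∂ν) ^ s * ∫⁻ x, u x ^ (-s) ∂ν := by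
  have hs1 : 0 < 1 + s := by linarith
  have hH := ENNReal.lintegral_mul_norm_pow_le (p := s / (1 + s)) (q := 1 / (1 + s)) hu
    (hu.pow_const (-s)) (by positivity) (by positivity) (by field_simp; ring)
  have hone : ∫⁻ x, u x ^ (s / (1 + s)) * (u x ^ (-s)) ^ (1 / (1 + s)) ∂ν = ν Set.univ := by
    rw [← lintegral_one]
    refine lintegral_congr_ae ?_
    filter_upwards [h0, htop] with x h0 ht
    rw [← ENNReal.rpow_mul, ← ENNReal.rpow_add _ _ h0 ht]
    convert ENNReal.rpow_zero
    ring
  rw [hone] at hH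
  calc ν Set.univ ^ (1 + s) ≤ _ := ENNReal.rpow_le_rpow hH hs1.le
    _ = _ := by
      rw [ENNReal.mul_rpow_of_nonneg _ _ hs1.le, ← ENNReal.rpow_mul, ← ENNReal.rpow_mul,
        div_mul_cancel₀ _ hs1.ne', div_mul_cancel₀ _ hs1.ne', ENNReal.rpow_one]

/-- The left side is `|P|^{1+s} (∫_P u)^{-s}`. Sparsity replaces `|P|` by `2|E|`, and Hölder's
inequality on `E` produces `(∫_E u)^s ≤ (∫_P u)^s`, which cancels. -/
lemma measure_mul_laverage_rpow_neg_le {X : Type*} [MeasurableSpace X] {μ : Measure X}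
    {u : X → ℝ≥0∞} (hu : AEMeasurable u μ) (h0 : ∀ᵐ x ∂μ, u x ≠ 0) (htop : ∀ᵐ x ∂μ, u x ≠ ∞)
    {s : ℝ} (hs : 0 ≤ s) {P E : Set X} (hE : E ⊆ P) (hPE : μ P ≤ 2 * μ E)
    (hP0 : μ P ≠ 0) (hPtop : μ P ≠ ∞)
    (hu0 : ∫⁻ x in P, u x ∂μ ≠ 0) (hutop : ∫⁻ x in P, u x ∂μ ≠ ∞) :
    μ P * (⨍⁻ x in P, u x ∂μ) ^ (-s) ≤ 2 ^ (1 + s) * ∫⁻ x in E, u x ^ (-s) ∂μ := by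
  have hs1 : 0 < 1 + s := by linarith
  have hH := measure_rpow_le_lintegral_rpow_mul (ν := μ.restrict E) hu.restrict
    (ae_restrict_of_ae h0) (ae_restrict_of_ae htop) hs
  rw [Measure.restrict_apply_univ] at hH
  set U := ∫⁻ x in P, u x ∂μ with hU
  have hlhs : μ P * (⨍⁻ x in P, u x ∂μ) ^ (-s) = (U ^ s)⁻¹ * μ P ^ (1 + s) := by
    rw [setLAverage_eq, div_eq_mul_inv, ← hU, ENNReal.mul_rpow_of_ne_zero hu0 (by simpa using hPtop),
      ENNReal.inv_rpow, ENNReal.rpow_neg, ENNReal.rpow_neg, inv_inv,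
      ENNReal.rpow_add _ _ hP0 hPtop, ENNReal.rpow_one]
    ring
  rw [hlhs, mul_comm, ← div_eq_mul_inv]
  refine ENNReal.div_le_of_le_mul ?_
  calc μ P ^ (1 + s) ≤ (2 * μ E) ^ (1 + s) := ENNReal.rpow_le_rpow hPE hs1.le
    _ = 2 ^ (1 + s) * μ E ^ (1 + s) := ENNReal.mul_rpow_of_nonneg _ _ hs1.le
    _ ≤ 2 ^ (1 + s) * (U ^ s * ∫⁻ x in E, u x ^ (-s) ∂μ) := by
      refine mul_le_mul_right (hH.trans (mul_le_mul_left ?_ _)) _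
      exact ENNReal.rpow_le_rpow (lintegral_mono_set hE) hs
    _ = _ := by ring

/-- On a sparse piece `E` of a set `P`, the product of the masses of the weight and of its dual
is controlled by the `A^p` characteristic to the sharp power. -/
lemma laverage_mul_lintegral_dual_le {X : Type*} [MeasurableSpace X] {μ : Measure X} {p : ℝ}
    (hp : 1 < p) {W : X → ℝ≥0∞} (hW : AEMeasurable W μ) (h0 : ∀ᵐ x ∂μ, W x ≠ 0)
    (htop : ∀ᵐ x ∂μ, W x ≠ ∞) {P E : Set X} (hE : E ⊆ P) (hPE : μ P ≤ 2 * μ E)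
    (hP0 : μ P ≠ 0) (hPtop : μ P ≠ ∞)
    (hW0 : ∫⁻ x in P, W x ∂μ ≠ 0) (hWtop : ∫⁻ x in P, W x ∂μ ≠ ∞)
    (hS0 : ∫⁻ x in P, W x ^ (-(1 / (p - 1))) ∂μ ≠ 0)
    (hStop : ∫⁻ x in P, W x ^ (-(1 / (p - 1))) ∂μ ≠ ∞) {K : ℝ≥0∞}
    (hK : (⨍⁻ x in P, W x ∂μ) * (⨍⁻ x in P, W x ^ (-(1 / (p - 1))) ∂μ) ^ (p - 1) ≤ K) :
    (⨍⁻ x in P, W x ∂μ) * ∫⁻ x in P, W x ^ (-(1 / (p - 1))) ∂μ ≤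
      2 ^ (p + p.conjExponent) * K ^ max 1 (1 / (p - 1)) *
        ∫⁻ x in E, W x ^ ((p - 2) / (p - 1)) ∂μ := by
  have hp1 : 0 < p - 1 := by linarith
  have hq : p.conjExponent = 1 + 1 / (p - 1) := by
    rw [Real.conjExponent]; field_simp; ring
  have hq0 : 0 < 1 / (p - 1) := by positivity
  set c := ⨍⁻ x in P, W x ^ (-(1 / (p - 1))) ∂μ with hc
  set a := ⨍⁻ x in P, W x ∂μ with ha
  have hS : ∫⁻ x in P, W x ^ (-(1 / (p - 1))) ∂μ = c * μ P := by
    rw [hc, setLAverage_eq, ENNReal.div_mul_cancel hP0 hPtop]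
  have ha0 : a ≠ 0 := by rw [ha, setLAverage_eq]; exact ENNReal.div_ne_zero.2 ⟨hW0, hPtop⟩
  have hatop : a ≠ ∞ := (setLAverage_lt_top hWtop).ne
  have hc0 : c ≠ 0 := by rw [hc, setLAverage_eq]; exact ENNReal.div_ne_zero.2 ⟨hS0, hPtop⟩
  have hctop : c ≠ ∞ := (setLAverage_lt_top hStop).ne
  rw [hS]
  -- For `p ≥ 2` one factor `a * c ^ (p-1)` is split off and a negative power of the dual average
  -- `c` remains; for `p < 2` its power `1/(p-1)` is split off and a negative power of `a` remains.
  -- Both remainders lead to the integrand `W ^ ((p-2)/(p-1))`, with constants `2 ^ (p-1)` and `2 ^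
  -- (1/(p-1))`.
  rcases le_or_gt 2 p with h2 | h2
  · have hmax : max 1 (1 / (p - 1)) = 1 := max_eq_left (by rw [div_le_one hp1]; linarith)
    have hσ0 : ∀ᵐ x ∂μ, W x ^ (-(1 / (p - 1))) ≠ 0 := by
      filter_upwards [h0, htop] with x h0 ht
      simp [ENNReal.rpow_eq_zero_iff, h0, ht]
    have hσt : ∀ᵐ x ∂μ, W x ^ (-(1 / (p - 1))) ≠ ∞ := by
      filter_upwards [h0, htop] with x h0 ht
      exact ENNReal.rpow_ne_top_of_ne_zero h0 ht
    have hkey := measure_mul_laverage_rpow_neg_le (hW.pow_const (-(1 / (p - 1)))) hσ0 hσt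
      (s := p - 2) (by linarith) hE hPE hP0 hPtop hS0 hStop
    rw [← hc] at hkey
    have hpow : ∀ x, (W x ^ (-(1 / (p - 1)))) ^ (-(p - 2)) = W x ^ ((p - 2) / (p - 1)) := by
      intro x
      rw [← ENNReal.rpow_mul]
      congr 1; ring
    simp only [hpow] at hkey
    have hsplit : c = c ^ (p - 1) * c ^ (-(p - 2)) := by
      rw [← ENNReal.rpow_add _ _ hc0 hctop]
      ring_nf
      exact (ENNReal.rpow_one c).symm
    calc a * (c * μ P) = a * c ^ (p - 1) * (μ P * c ^ (-(p - 2))) := by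
          conv_lhs => rw [hsplit]
          ring
      _ ≤ K * (2 ^ (1 + (p - 2)) * ∫⁻ x in E, W x ^ ((p - 2) / (p - 1)) ∂μ) := by gcongr
      _ ≤ K * (2 ^ (p + p.conjExponent) * ∫⁻ x in E, W x ^ ((p - 2) / (p - 1)) ∂μ) := by
          gcongr K * (?_ * _)
          exact ENNReal.rpow_le_rpow_of_exponent_le one_le_two (by rw [hq]; linarith)
      _ = _ := by rw [hmax, ENNReal.rpow_one]; ring
  · have hmax : max 1 (1 / (p - 1)) = 1 / (p - 1) :=
      max_eq_right (by rw [le_div_iff₀ hp1]; linarith)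
    have hkey := measure_mul_laverage_rpow_neg_le hW h0 htop
      (s := (2 - p) / (p - 1)) (div_nonneg (by linarith) hp1.le) hE hPE hP0 hPtop hW0 hWtop
    have hexp : -((2 - p) / (p - 1)) = (p - 2) / (p - 1) := by ring
    rw [hexp, ← ha] at hkey
    have hsplit : a * c = (a * c ^ (p - 1)) ^ (1 / (p - 1)) * a ^ ((p - 2) / (p - 1)) := by
      rw [ENNReal.mul_rpow_of_nonneg _ _ hq0.le, ← ENNReal.rpow_mul, mul_one_div_cancel hp1.ne',
        ENNReal.rpow_one, mul_right_comm, ← ENNReal.rpow_add _ _ ha0 hatop]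
      have : 1 / (p - 1) + (p - 2) / (p - 1) = 1 := by field_simp; ring
      rw [this, ENNReal.rpow_one]
    have hle : (1 : ℝ) + (2 - p) / (p - 1) = 1 / (p - 1) := by field_simp; ring
    calc a * (c * μ P) = (a * c ^ (p - 1)) ^ (1 / (p - 1)) * (μ P * a ^ ((p - 2) / (p - 1))) := by
          rw [← mul_assoc, hsplit]; ring
      _ ≤ K ^ (1 / (p - 1)) *
          (2 ^ (1 + (2 - p) / (p - 1)) * ∫⁻ x in E, W x ^ ((p - 2) / (p - 1)) ∂μ) := by gcongr
      _ ≤ K ^ (1 / (p - 1)) *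
          (2 ^ (p + p.conjExponent) * ∫⁻ x in E, W x ^ ((p - 2) / (p - 1)) ∂μ) := by
          gcongr K ^ (1 / (p - 1)) * (?_ * _)
          exact ENNReal.rpow_le_rpow_of_exponent_le one_le_two (by rw [hle, hq]; linarith)
      _ = _ := by rw [hmax]; ring

/-! ### Sparse sums in the dual weighted space. -/

namespace NestedPartition

variable {X ι : Type*} [MeasurableSpace X] [Countable ι] (D : NestedPartition X ι)
  {μ : Measure X}

/-- The sharp weighted bound for sparse sums of averages of the weight. -/
theorem lintegral_sparse_rpow_le {p q : ℝ} (hpq : p.HolderConjugate q)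
    {W σ g : X → ℝ≥0∞} (hW : AEMeasurable W μ) (hσ : AEMeasurable σ μ)
    (hg : ∀ᵐ x ∂μ, g x = σ x ^ (1 / p) * W x ^ (1 / q)) (x₀ : X)
    (hσtop : ∫⁻ x in D.cell 0 x₀, σ x ∂μ ≠ ∞)
    (hWbdd : ∀ k, ∃ c : ℝ≥0∞, c ≠ ∞ ∧
      ∀ x ∈ D.cell 0 x₀, ⨍⁻ z in D.cell k x, W z ∂μ ≤ c)
    {S : ℕ → Set X} (hS : ∀ k, D.IsLevel k (· ∈ S k)) {B : ℝ≥0∞}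
    (hB : ∀ k, ∀ x ∈ D.cell 0 x₀, x ∈ S k →
      (⨍⁻ z in D.cell k x, W z ∂μ) * ∫⁻ z in D.cell k x, σ z ∂μ ≤
        B * ∫⁻ z in D.cell k x ∩ (S k \ ⋃ j > k, S j), g z ∂μ) (N : ℕ) :
    ∫⁻ x in D.cell 0 x₀, (∑ k ∈ Finset.range N,
        (S k).indicator (fun y => ⨍⁻ z in D.cell k y, W z ∂μ) x) ^ q * σ x ∂μ ≤
      (ENNReal.ofReal q * B) ^ q * ∫⁻ x in D.cell 0 x₀, W x ∂μ := by
  have hq1 : 0 < q - 1 := hpq.symm.sub_one_pos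
  set Q := D.cell 0 x₀ with hQ
  set a : ℕ → X → ℝ≥0∞ :=
    fun k => (S k).indicator (fun y => ⨍⁻ z in D.cell k y, W z ∂μ) with ha
  set F : ℕ → X → ℝ≥0∞ := fun N x => ∑ k ∈ Finset.range N, a k x with hF
  set E : ℕ → Set X := fun k => S k \ ⋃ j > k, S j with hEdef
  have hSm : ∀ k, MeasurableSet (S k) := fun k => (hS k).measurableSet
  have hEm : ∀ k, MeasurableSet (E k) := fun k =>
    (hSm k).diff (MeasurableSet.biUnion (Set.to_countable _) fun j _ => hSm j)
  have hgm : AEMeasurable g μ :=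
    ((hσ.pow_const (1 / p)).mul (hW.pow_const (1 / q))).congr (hg.mono fun x hx => hx.symm)
  have halevel : ∀ k, D.IsLevel k (a k) := by
    intro k x y hxy
    have h1 : x ∈ S k ↔ y ∈ S k := (hS k x y hxy).to_iff
    by_cases hx : x ∈ S k
    · simp only [ha, Set.indicator_of_mem hx, Set.indicator_of_mem (h1.1 hx), D.cell_eq hxy]
    · simp only [ha, Set.indicator_of_notMem hx, Set.indicator_of_notMem (mt h1.2 hx)]
  have ham : ∀ k, Measurable (a k) := fun k => (halevel k).measurable
  have hFlevel : ∀ k, D.IsLevel k (F (k + 1)) := by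
    intro k x y hxy
    refine Finset.sum_congr rfl fun j hj => (halevel j).mono ?_ x y hxy
    exact Nat.lt_succ_iff.1 (Finset.mem_range.1 hj)
  have hFm : ∀ k, Measurable (F k) := fun k => Finset.measurable_fun_sum _ fun j _ => ham j
  -- On a cell of level `k` both `a k` and `F (k + 1)` are constant, so `hB` applies with them
  -- pulled out.
  have hcell : ∀ k, ∫⁻ x in Q, a k x * F (k + 1) x ^ (q - 1) * σ x ∂μ ≤
      ∫⁻ x in Q, B * (E k).indicator (fun x => F (k + 1) x ^ (q - 1) * g x) x ∂μ := by
    intro k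
    refine D.setLIntegral_le_of_forall_cell k.zero_le x₀ fun y hy => ?_
    have hleft : ∫⁻ z in D.cell k y, a k z * F (k + 1) z ^ (q - 1) * σ z ∂μ =
        a k y * F (k + 1) y ^ (q - 1) * ∫⁻ z in D.cell k y, σ z ∂μ := by
      rw [← lintegral_const_mul'' _ hσ.restrict]
      refine setLIntegral_congr_fun (D.measurableSet_cell k y) fun z hz => ?_
      simp only [halevel k z y hz, hFlevel k z y hz]
    have hright : ∫⁻ z in D.cell k y,
        B * (E k).indicator (fun x => F (k + 1) x ^ (q - 1) * g x) z ∂μ =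
        B * F (k + 1) y ^ (q - 1) * ∫⁻ z in D.cell k y ∩ E k, g z ∂μ := by
      have : ∀ z ∈ D.cell k y, B * (E k).indicator (fun x => F (k + 1) x ^ (q - 1) * g x) z =
          B * F (k + 1) y ^ (q - 1) * (E k).indicator g z := by
        intro z hz
        by_cases hzE : z ∈ E k
        · simp only [Set.indicator_of_mem hzE, hFlevel k z y hz, mul_assoc]
        · simp only [Set.indicator_of_notMem hzE, mul_zero]
      rw [setLIntegral_congr_fun (D.measurableSet_cell k y) this,
        lintegral_const_mul'' _ (hgm.restrict.indicator (hEm k)), setLIntegral_indicator (hEm k),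
        Set.inter_comm]
    rw [hleft, hright]
    by_cases hyS : y ∈ S k
    · have hay : a k y = ⨍⁻ z in D.cell k y, W z ∂μ := Set.indicator_of_mem hyS _
      calc _ = F (k + 1) y ^ (q - 1) * ((⨍⁻ z in D.cell k y, W z ∂μ) *
            ∫⁻ z in D.cell k y, σ z ∂μ) := by rw [hay]; ring
        _ ≤ F (k + 1) y ^ (q - 1) * (B * ∫⁻ z in D.cell k y ∩ E k, g z ∂μ) :=
            mul_le_mul_right (hB k y hy hyS) _
        _ = _ := by ring
    · have hay : a k y = 0 := Set.indicator_of_notMem hyS _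
      simp [hay]
  -- The sets `E k` are disjoint, so at most one term survives, and `F (k + 1) ≤ F N` there.
  have hdisj : ∀ x, ∑ k ∈ Finset.range N, (E k).indicator (fun x => F (k + 1) x ^ (q - 1) * g x) x
      ≤ F N x ^ (q - 1) * g x := by
    intro x
    by_cases hx : ∃ k ∈ Finset.range N, x ∈ E k
    · obtain ⟨k, hk, hxk⟩ := hx
      rw [Finset.sum_eq_single k, Set.indicator_of_mem hxk]
      · gcongr
        exact Finset.sum_le_sum_of_subset
          (Finset.range_subset_range.2 (Finset.mem_range.1 hk))
      · intro j _ hjk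
        refine Set.indicator_of_notMem (fun hxj => ?_) _
        have hk2 := hxk.2
        have hj2 := hxj.2
        simp only [Set.mem_iUnion, not_exists] at hk2 hj2
        rcases lt_or_gt_of_ne hjk with h | h
        · exact hj2 k h hxk.1
        · exact hk2 j h hxj.1
      · exact fun h => absurd hk h
    · push Not at hx
      rw [Finset.sum_eq_zero fun k hk => Set.indicator_of_notMem (hx k hk) _]
      exact zero_le
  set I := ∫⁻ x in Q, F N x ^ q * σ x ∂μ with hI
  -- Finiteness licenses the absorption at the end; it comes from truncating the sum at `N` and from
  -- `hWbdd`.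
  have hItop : I ≠ ∞ := by
    choose c hc hcb using hWbdd
    have hle : I ≤ ∫⁻ x in Q, (∑ k ∈ Finset.range N, c k) ^ q * σ x ∂μ := by
      refine setLIntegral_mono' (D.measurableSet_cell 0 x₀) fun x hx => ?_
      exact mul_le_mul_left (ENNReal.rpow_le_rpow (Finset.sum_le_sum fun k _ =>
        (Set.indicator_le_self _ _ x).trans (hcb k x hx)) hpq.symm.nonneg) _
    have hctop : (∑ k ∈ Finset.range N, c k) ^ q ≠ ∞ :=
      ENNReal.rpow_ne_top_of_nonneg hpq.symm.nonneg (ENNReal.sum_ne_top.2 fun k _ => hc k)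
    rw [lintegral_const_mul' _ _ hctop] at hle
    exact ne_top_of_le_ne_top (ENNReal.mul_ne_top hctop hσtop) hle
  have hHolder : ∫⁻ x in Q, F N x ^ (q - 1) * g x ∂μ ≤
      I ^ (1 / p) * (∫⁻ x in Q, W x ∂μ) ^ (1 / q) := by
    have hH := ENNReal.lintegral_mul_le_Lp_mul_Lq (μ.restrict Q) hpq
      (f := fun x => F N x ^ (q - 1) * σ x ^ (1 / p)) (g := fun x => W x ^ (1 / q))
      (((hFm N).pow_const _).aemeasurable.mul (hσ.restrict.pow_const _)) (hW.restrict.pow_const _)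
    have h1 : ∀ x, (F N x ^ (q - 1) * σ x ^ (1 / p)) ^ p = F N x ^ q * σ x := by
      intro x
      rw [ENNReal.mul_rpow_of_nonneg _ _ hpq.nonneg, ← ENNReal.rpow_mul, ← ENNReal.rpow_mul,
        one_div_mul_cancel hpq.ne_zero, ENNReal.rpow_one, mul_comm (q - 1) p,
        mul_sub, mul_one]
      congr 2
      linarith [hpq.mul_eq_add]
    have h2 : ∀ x, (W x ^ (1 / q)) ^ q = W x := by
      intro x
      rw [← ENNReal.rpow_mul, one_div_mul_cancel hpq.symm.ne_zero, ENNReal.rpow_one]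
    simp only [h1, h2] at hH
    refine le_trans (le_of_eq ?_) hH
    refine lintegral_congr_ae ?_
    filter_upwards [ae_restrict_of_ae hg] with x hx
    simp only [Pi.mul_apply, hx, mul_assoc]
  have hmain : I ≤ ENNReal.ofReal q * B * (∫⁻ x in Q, W x ∂μ) ^ (1 / q) * I ^ (1 / p) := by
    calc I ≤ ∫⁻ x in Q, ENNReal.ofReal q *
          ∑ k ∈ Finset.range N, a k x * F (k + 1) x ^ (q - 1) * σ x ∂μ := by
          refine lintegral_mono fun x => ?_
          rw [← Finset.sum_mul, ← mul_assoc]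
          exact mul_le_mul_left (sum_range_rpow_le hpq.symm.lt (fun k => a k x) N) _
      _ = ENNReal.ofReal q *
          ∑ k ∈ Finset.range N, ∫⁻ x in Q, a k x * F (k + 1) x ^ (q - 1) * σ x ∂μ := by
          rw [lintegral_const_mul' _ _ ENNReal.ofReal_ne_top, lintegral_finsetSum']
          exact fun k _ => ((ham k).mul ((hFm _).pow_const _)).aemeasurable.mul hσ.restrict
      _ ≤ ENNReal.ofReal q * ∑ k ∈ Finset.range N,
          ∫⁻ x in Q, B * (E k).indicator (fun x => F (k + 1) x ^ (q - 1) * g x) x ∂μ := by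
          exact mul_le_mul_right (Finset.sum_le_sum fun k _ => hcell k) _
      _ = ENNReal.ofReal q * (B * ∫⁻ x in Q, ∑ k ∈ Finset.range N,
          (E k).indicator (fun x => F (k + 1) x ^ (q - 1) * g x) x ∂μ) := by
          have hm : ∀ k, AEMeasurable ((E k).indicator (fun x => F (k + 1) x ^ (q - 1) * g x))
              (μ.restrict Q) := fun k =>
            (((hFm _).pow_const _).aemeasurable.mul hgm.restrict).indicator (hEm k)
          rw [lintegral_finsetSum' _ fun k _ => hm k]
          simp only [lintegral_const_mul'' _ (hm _), Finset.mul_sum]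
      _ ≤ ENNReal.ofReal q * (B * ∫⁻ x in Q, F N x ^ (q - 1) * g x ∂μ) := by
          gcongr with x
          exact hdisj x
      _ ≤ ENNReal.ofReal q * (B * (I ^ (1 / p) * (∫⁻ x in Q, W x ∂μ) ^ (1 / q))) := by gcongr
      _ = _ := by ring
  refine (le_rpow_of_le_mul_rpow hpq hItop hmain).trans_eq ?_
  rw [ENNReal.mul_rpow_of_nonneg _ _ hpq.symm.nonneg, ← ENNReal.rpow_mul,
    one_div_mul_cancel hpq.symm.ne_zero, ENNReal.rpow_one]

end NestedPartition

/-! ### Cubes and dyadic grids. -/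

variable {n : ℕ}

lemma cube_eq_closedBall (a : Fin n → ℝ) {l : ℝ} (hl : 0 < l) :
    cube a l = Metric.closedBall (fun i => a i + l / 2) (l / 2) := by
  rw [closedBall_pi _ (by positivity), cube, ← Set.pi_univ_Icc]
  congr 1
  ext i x
  simp only [Set.mem_Icc, Real.closedBall_eq_Icc]
  constructor <;> rintro ⟨h1, h2⟩ <;> constructor <;> linarith

lemma volume_cube (a : Fin n → ℝ) (l : ℝ) : volume (cube a l) = ENNReal.ofReal l ^ n := by
  rw [cube, Real.volume_Icc_pi]
  simp

lemma volume_cube_ne_zero (a : Fin n → ℝ) {l : ℝ} (hl : 0 < l) : volume (cube a l) ≠ 0 := by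
  rw [volume_cube]
  exact pow_ne_zero _ (by simpa using hl)

lemma volume_cube_ne_top (a : Fin n → ℝ) (l : ℝ) : volume (cube a l) ≠ ∞ := by
  rw [volume_cube]
  exact ENNReal.pow_ne_top ENNReal.ofReal_ne_top

/-- The grid of dyadic subcubes generated by the half-open cube with corner `a` and side `l`. -/
noncomputable def dyadicGrid (a : Fin n → ℝ) (l : ℝ) :
    NestedPartition (Fin n → ℝ) (Fin n → ℤ) where
  idx k x i := ⌊(x i - a i) / l * 2 ^ k⌋
  measurableSet_fiber k m := by
    have : Measurable fun (x : Fin n → ℝ) (i : Fin n) => ⌊(x i - a i) / l * 2 ^ k⌋ :=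
      measurable_pi_lambda _ fun i =>
        Int.measurable_floor.comp ((((measurable_pi_apply i).sub_const _).div_const _).mul_const _)
    exact this (measurableSet_singleton m)
  nested k x y h := by
    ext i
    have hfl : ∀ t : ℝ, ⌊t * 2 ^ k⌋ = ⌊t * 2 ^ (k + 1)⌋ / 2 := by
      intro t
      have := Int.floor_div_natCast (t * 2 ^ (k + 1)) 2
      rw [pow_succ] at this ⊢
      rw [← Nat.cast_ofNat (R := ℤ), ← this]
      congr 1
      push_cast
      ring
    have hi := congrFun h i
    change ⌊_⌋ = ⌊_⌋ at hi
    change ⌊_⌋ = ⌊_⌋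
    rw [hfl, hfl, hi]

/-- The lower corner of the dyadic cube of level `k` that contains `x`. -/
noncomputable def dyadicCorner (a : Fin n → ℝ) (l : ℝ) (k : ℕ) (x : Fin n → ℝ) : Fin n → ℝ :=
  fun i => a i + l / 2 ^ k * ⌊(x i - a i) / l * 2 ^ k⌋

lemma dyadicGrid_cell (a : Fin n → ℝ) {l : ℝ} (hl : 0 < l) (k : ℕ) (x : Fin n → ℝ) :
    (dyadicGrid a l).cell k x = Set.pi Set.univ fun i =>
      Set.Ico (dyadicCorner a l k x i) (dyadicCorner a l k x i + l / 2 ^ k) := by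
  ext y
  simp only [NestedPartition.mem_cell_iff, dyadicGrid, funext_iff, Set.mem_pi, Set.mem_univ,
    true_imp_iff, Set.mem_Ico, dyadicCorner]
  refine forall_congr' fun i => ?_
  set m := ⌊(x i - a i) / l * 2 ^ k⌋
  have h2 : (0 : ℝ) < 2 ^ k := by positivity
  have hs : 0 < l / 2 ^ k := by positivity
  have hy : (y i - a i) / l * 2 ^ k = (y i - a i) / (l / 2 ^ k) := by field_simp
  rw [Int.floor_eq_iff, hy, le_div_iff₀ hs, div_lt_iff₀ hs]
  constructor <;> rintro ⟨h1, h2⟩ <;> constructor <;> linarith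

/-- Half-open cells partition space while the norms use closed cubes; the faces are null, so
integrals and averages agree. -/
lemma dyadicGrid_cell_ae_eq (a : Fin n → ℝ) {l : ℝ} (hl : 0 < l) (k : ℕ) (x : Fin n → ℝ) :
    (dyadicGrid a l).cell k x =ᵐ[volume] cube (dyadicCorner a l k x) (l / 2 ^ k) := by
  rw [dyadicGrid_cell a hl]
  exact Measure.univ_pi_Ico_ae_eq_Icc

lemma dyadicCorner_zero_self (a : Fin n → ℝ) (l : ℝ) : dyadicCorner a l 0 a = a := by
  ext i
  simp [dyadicCorner]

lemma dyadicGrid_cell_zero_ae_eq (a : Fin n → ℝ) {l : ℝ} (hl : 0 < l) :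
    (dyadicGrid a l).cell 0 a =ᵐ[volume] cube a l := by
  simpa [dyadicCorner_zero_self] using dyadicGrid_cell_ae_eq a hl 0 a

lemma volume_dyadicGrid_cell (a : Fin n → ℝ) {l : ℝ} (hl : 0 < l) (k : ℕ) (x : Fin n → ℝ) :
    volume ((dyadicGrid a l).cell k x) = ENNReal.ofReal (l / 2 ^ k) ^ n := by
  rw [measure_congr (dyadicGrid_cell_ae_eq a hl k x), volume_cube]

lemma volume_dyadicGrid_cell_succ (a : Fin n → ℝ) {l : ℝ} (hl : 0 < l) (k : ℕ) (x : Fin n → ℝ) :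
    volume ((dyadicGrid a l).cell k x) = 2 ^ n * volume ((dyadicGrid a l).cell (k + 1) x) := by
  rw [volume_dyadicGrid_cell a hl, volume_dyadicGrid_cell a hl, ← mul_pow,
    ← ENNReal.ofReal_ofNat 2, ← ENNReal.ofReal_mul (by norm_num)]
  congr 2
  field_simp
  ring

/-- The Lebesgue differentiation theorem along dyadic cubes. -/
lemma ae_tendsto_mean_dyadicGrid (a : Fin n → ℝ) {l : ℝ} (hl : 0 < l) {b : (Fin n → ℝ) → ℂ}
    (hb : LocallyIntegrable b) :
    ∀ᵐ x, Filter.Tendsto (fun k => (dyadicGrid a l).mean volume b k x) Filter.atTop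
      (nhds (b x)) := by
  -- Closed cubes are sup-norm balls not centred at `x`; the dilation parameter `1` suffices because
  -- each contains `x`.
  filter_upwards [IsUnifLocDoublingMeasure.ae_tendsto_average volume hb 1] with x hx
  have hmean : ∀ k, (dyadicGrid a l).mean volume b k x =
      ⨍ z in Metric.closedBall (fun i => dyadicCorner a l k x i + l / 2 ^ k / 2) (l / 2 ^ k / 2),
        b z := by
    intro k
    rw [← cube_eq_closedBall _ (by positivity)]
    exact setAverage_congr (dyadicGrid_cell_ae_eq a hl k x)
  simp only [hmean]
  refine hx _ _ ?_ (Filter.Eventually.of_forall fun k => ?_)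
  · refine tendsto_nhdsWithin_iff.2 ⟨?_, Filter.Eventually.of_forall fun k => ?_⟩
    · have h := (tendsto_inv_atTop_zero.comp
        (tendsto_pow_atTop_atTop_of_one_lt (one_lt_two : (1 : ℝ) < 2))).const_mul (l / 2)
      rw [mul_zero] at h
      refine h.congr fun k => ?_
      simp only [Function.comp_apply]
      ring
    · exact Set.mem_Ioi.2 (by positivity)
  · rw [one_mul, ← cube_eq_closedBall _ (by positivity), cube, ← Set.pi_univ_Icc]
    have hmem := (dyadicGrid a l).mem_cell_self k x
    rw [dyadicGrid_cell a hl] at hmem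
    exact Set.pi_mono (fun i _ => Set.Ico_subset_Icc_self) hmem

lemma setLIntegral_ne_zero {X : Type*} [MeasurableSpace X] {μ : Measure X} {f : X → ℝ≥0∞}
    (hf : AEMeasurable f μ) (h0 : ∀ᵐ x ∂μ, f x ≠ 0) {P : Set X} (hP : μ P ≠ 0) :
    ∫⁻ x in P, f x ∂μ ≠ 0 := by
  rw [Ne, lintegral_eq_zero_iff' hf.restrict]
  intro h
  refine hP ?_
  rw [← Measure.restrict_eq_zero, ← ae_eq_bot, ← Filter.eventually_false_iff_eq_bot]
  filter_upwards [h, ae_restrict_of_ae h0] with x h1 h2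
  exact h2 h1

lemma laverage_mul_laverage_dual_le_apConst (p : ℝ) (w : (Fin n → ℝ) → ℝ)
    (a : Fin n → ℝ) {l : ℝ} (hl : 0 < l) :
    (⨍⁻ x in cube a l, ENNReal.ofReal (w x) ∂volume) *
      (⨍⁻ x in cube a l, ENNReal.ofReal (w x) ^ (-(1 / (p - 1))) ∂volume) ^ (p - 1) ≤ apConst p w :=
  le_iSup_of_le a (le_iSup_of_le l (le_iSup_of_le hl le_rfl))

/-! ### Nondegeneracy of `A^p` weights. -/

namespace IsApWeight

variable {p : ℝ} {w : (Fin n → ℝ) → ℝ} (hw : IsApWeight p w)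

include hw

lemma aemeasurable : AEMeasurable fun x => ENNReal.ofReal (w x) :=
  hw.locallyIntegrable.aestronglyMeasurable.aemeasurable.ennreal_ofReal

lemma ae_ne_zero : ∀ᵐ x, ENNReal.ofReal (w x) ≠ 0 :=
  hw.pos.mono fun x hx => by simpa using hx

lemma wMass_ne_zero (a : Fin n → ℝ) {l : ℝ} (hl : 0 < l) : wMass w a l ≠ 0 :=
  setLIntegral_ne_zero hw.aemeasurable hw.ae_ne_zero (volume_cube_ne_zero a hl)

lemma wMass_ne_top (a : Fin n → ℝ) (l : ℝ) : wMass w a l ≠ ∞ := by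
  have h := (hw.locallyIntegrable.integrableOn_isCompact
    (isCompact_Icc : IsCompact (cube a l))).2
  exact ne_top_of_le_ne_top h.ne (lintegral_mono fun x => Real.ofReal_le_enorm _)

lemma dual_ne_zero : ∀ᵐ x, ENNReal.ofReal (w x) ^ (-(1 / (p - 1))) ≠ 0 :=
  hw.ae_ne_zero.mono fun x hx => by simp [ENNReal.rpow_eq_zero_iff, hx]

lemma dual_ne_top : ∀ᵐ x, ENNReal.ofReal (w x) ^ (-(1 / (p - 1))) ≠ ∞ :=
  hw.ae_ne_zero.mono fun _ hx => ENNReal.rpow_ne_top_of_ne_zero hx ENNReal.ofReal_ne_top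

/-- The average of `w` is nonzero, so an infinite dual integral would make the characteristic
infinite. -/
lemma lintegral_dual_ne_top (hp : 1 < p) (a : Fin n → ℝ) {l : ℝ} (hl : 0 < l) :
    ∫⁻ x in cube a l, ENNReal.ofReal (w x) ^ (-(1 / (p - 1))) ≠ ∞ := by
  intro h
  have hle := laverage_mul_laverage_dual_le_apConst p w a hl
  have hW : ⨍⁻ x in cube a l, ENNReal.ofReal (w x) ∂volume ≠ 0 := by
    rw [setLAverage_eq]
    exact ENNReal.div_ne_zero.2 ⟨hw.wMass_ne_zero a hl, volume_cube_ne_top a l⟩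
  rw [setLAverage_eq volume (fun x => ENNReal.ofReal (w x) ^ (-(1 / (p - 1)))), h,
    ENNReal.top_div_of_ne_top (volume_cube_ne_top a l),
    ENNReal.top_rpow_of_pos (by linarith), ENNReal.mul_top hW] at hle
  exact hw.apConst_lt_top.not_ge hle

end IsApWeight

/-! ### The endpoint estimate `r = p'`. -/

/-- The oscillation of `b` on a cube is at most `‖b‖_{BMO_w}` times the mass of the cube. -/
lemma lintegral_enorm_sub_average_le {p : ℝ} {w : (Fin n → ℝ) → ℝ} (hw : IsApWeight p w)
    (b : (Fin n → ℝ) → ℂ) (a : Fin n → ℝ) {l : ℝ} (hl : 0 < l) :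
    ∫⁻ x in cube a l, ‖b x - ⨍ y in cube a l, b y‖ₑ ≤ bmoNorm w b * wMass w a l := by
  rw [← ENNReal.div_le_iff (hw.wMass_ne_zero a hl) (hw.wMass_ne_top a l)]
  exact le_iSup_of_le a (le_iSup_of_le l (le_iSup_of_le hl le_rfl))

/-- The weighted John–Nirenberg estimate on a cube, at the endpoint exponent. -/
theorem lintegral_enorm_sub_average_rpow_le {p : ℝ} (hp : 1 < p) {w : (Fin n → ℝ) → ℝ}
    (hw : IsApWeight p w) {b : (Fin n → ℝ) → ℂ} (hb : LocallyIntegrable b)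
    (a : Fin n → ℝ) {l : ℝ} (hl : 0 < l) :
    ∫⁻ x in cube a l, ‖b x - ⨍ y in cube a l, b y‖ₑ ^ p.conjExponent *
        ENNReal.ofReal (w x) ^ (-(1 / (p - 1))) ≤
      (2 * 2 ^ n * ENNReal.ofReal p.conjExponent * 2 ^ (p + p.conjExponent) *
        apConst p w ^ max 1 (1 / (p - 1)) * bmoNorm w b) ^ p.conjExponent * wMass w a l := by
  have hpq : p.HolderConjugate p.conjExponent := Real.HolderConjugate.conjExponent hp
  set q := p.conjExponent with hq
  have hq0 : 0 ≤ q := hpq.symm.nonneg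
  set W : (Fin n → ℝ) → ℝ≥0∞ := fun x => ENNReal.ofReal (w x) with hW
  set σ : (Fin n → ℝ) → ℝ≥0∞ := fun x => W x ^ (-(1 / (p - 1))) with hσ
  set K := apConst p w
  set β := bmoNorm w b
  set D := dyadicGrid a l with hD
  have hWm : AEMeasurable W := hw.aemeasurable
  have hσm : AEMeasurable σ := hWm.pow_const _
  have hvol0 : ∀ k x, volume (D.cell k x) ≠ 0 := fun k x => by
    rw [volume_dyadicGrid_cell a hl]
    exact pow_ne_zero _ (ENNReal.ofReal_pos.2 (by positivity)).ne'
  have hvolt : ∀ k x, volume (D.cell k x) ≠ ∞ := fun k x => by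
    rw [volume_dyadicGrid_cell a hl]
    exact ENNReal.pow_ne_top ENNReal.ofReal_ne_top
  have hvold : ∀ k x, volume (D.cell k x) ≤ 2 ^ n * volume (D.cell (k + 1) x) := fun k x =>
    (volume_dyadicGrid_cell_succ a hl k x).le
  have hd1 : (1 : ℝ≥0∞) ≤ 2 ^ n := one_le_pow₀ one_le_two
  have hdt : (2 : ℝ≥0∞) ^ n ≠ ∞ := ENNReal.pow_ne_top ENNReal.ofNat_ne_top
  have hbint : ∀ k x, IntegrableOn b (D.cell k x) := fun k x =>
    IntegrableOn.congr_set_ae (hb.integrableOn_isCompact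
      (isCompact_Icc : IsCompact (cube (dyadicCorner a l k x) (l / 2 ^ k))))
      (dyadicGrid_cell_ae_eq a hl k x)
  have hside : ∀ k : ℕ, 0 < l / 2 ^ k := fun k => by positivity
  have hcellInt : ∀ (f : (Fin n → ℝ) → ℝ≥0∞) k x, ∫⁻ z in D.cell k x, f z =
      ∫⁻ z in cube (dyadicCorner a l k x) (l / 2 ^ k), f z := fun f k x =>
    setLIntegral_congr (dyadicGrid_cell_ae_eq a hl k x)
  have hcellAvg : ∀ (f : (Fin n → ℝ) → ℝ≥0∞) k x, ⨍⁻ z in D.cell k x, f z ∂volume =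
      ⨍⁻ z in cube (dyadicCorner a l k x) (l / 2 ^ k), f z ∂volume := fun f k x =>
    setLAverage_congr (dyadicGrid_cell_ae_eq a hl k x)
  have hWcell0 : ∀ k x, ∫⁻ z in D.cell k x, W z ≠ 0 := fun k x => by
    rw [hcellInt]; exact hw.wMass_ne_zero _ (hside k)
  have hWcellt : ∀ k x, ∫⁻ z in D.cell k x, W z ≠ ∞ := fun k x => by
    rw [hcellInt]; exact hw.wMass_ne_top _ _
  have hσcell0 : ∀ k x, ∫⁻ z in D.cell k x, σ z ≠ 0 := fun k x =>
    setLIntegral_ne_zero hσm hw.dual_ne_zero (hvol0 k x)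
  have hσcellt : ∀ k x, ∫⁻ z in D.cell k x, σ z ≠ ∞ := fun k x => by
    rw [hcellInt]; exact hw.lintegral_dual_ne_top hp _ (hside k)
  have hdev : ∀ k x, D.dev volume b k k x ≤ β * ⨍⁻ z in D.cell k x, W z ∂volume := by
    intro k x
    have hmean : D.mean volume b k x =
        ⨍ y in cube (dyadicCorner a l k x) (l / 2 ^ k), b y :=
      setAverage_congr (dyadicGrid_cell_ae_eq a hl k x)
    rw [NestedPartition.dev, hcellAvg, hcellAvg, hmean, setLAverage_eq, setLAverage_eq,
      ← mul_div_assoc]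
    exact ENNReal.div_le_div_right (lintegral_enorm_sub_average_le hw b _ (hside k)) _
  set S : ℕ → Set (Fin n → ℝ) := fun k => {y | D.lastStop volume b k y = k} with hS
  have hSlevel : ∀ k, D.IsLevel k (· ∈ S k) := fun k x y hxy => by
    simp only [hS, Set.mem_ofPred_eq, D.isLevel_lastStop volume b k x y hxy]
  have hB : ∀ k, ∀ x ∈ D.cell 0 a, x ∈ S k →
      (⨍⁻ z in D.cell k x, W z ∂volume) * ∫⁻ z in D.cell k x, σ z ≤
        2 ^ (p + q) * K ^ max 1 (1 / (p - 1)) *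
          ∫⁻ z in D.cell k x ∩ (S k \ ⋃ j > k, S j), W z ^ ((p - 2) / (p - 1)) := by
    intro k x _ hx
    refine laverage_mul_lintegral_dual_le hp hWm hw.ae_ne_zero
      (Filter.Eventually.of_forall fun x => ENNReal.ofReal_ne_top) Set.inter_subset_left
      (D.measure_cell_le_two_mul hvol0 hvolt hbint hx) (hvol0 k x) (hvolt k x) (hWcell0 k x)
      (hWcellt k x) (hσcell0 k x) (hσcellt k x) ?_
    rw [hcellAvg, hcellAvg]
    exact laverage_mul_laverage_dual_le_apConst p w _ (hside k)
  have hg : ∀ᵐ x, W x ^ ((p - 2) / (p - 1)) = σ x ^ (1 / p) * W x ^ (1 / q) := by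
    filter_upwards [hw.ae_ne_zero] with x hx
    rw [hσ, ← ENNReal.rpow_mul, ← ENNReal.rpow_add _ _ hx ENNReal.ofReal_ne_top]
    congr 1
    have h1 : p - 1 ≠ 0 := by linarith
    have h2 : p ≠ 0 := by linarith
    rw [hq, Real.conjExponent]
    field_simp
    ring
  have hWbdd : ∀ k, ∃ c : ℝ≥0∞, c ≠ ∞ ∧
      ∀ x ∈ D.cell 0 a, ⨍⁻ z in D.cell k x, W z ∂volume ≤ c := by
    intro k
    -- All cells of level `k` have the same volume and those in question lie in the cell of level
    -- `0`.
    refine ⟨(∫⁻ z in D.cell 0 a, W z) / ENNReal.ofReal (l / 2 ^ k) ^ n,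
      ENNReal.div_ne_top (hWcellt 0 a) ?_, fun x hx => ?_⟩
    · rw [← volume_dyadicGrid_cell a hl k a]; exact hvol0 k a
    · rw [setLAverage_eq, volume_dyadicGrid_cell a hl]
      exact ENNReal.div_le_div_right
        (lintegral_mono_set (D.cell_subset_of_mem k.zero_le hx)) _
  have hsparse := D.lintegral_sparse_rpow_le hpq hWm hσm hg a (hσcellt 0 a) hWbdd hSlevel hB
  -- The bound is uniform in `k`, as Fatou's lemma requires.
  have hmeanLe : ∀ k, ∫⁻ x in D.cell 0 a,
      ‖D.mean volume b k x - D.mean volume b 0 a‖ₑ ^ q * σ x ≤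
      (2 * 2 ^ n * ENNReal.ofReal q * 2 ^ (p + q) * K ^ max 1 (1 / (p - 1)) * β) ^ q *
        wMass w a l := by
    intro k
    have hpt : ∀ x ∈ D.cell 0 a, ‖D.mean volume b k x - D.mean volume b 0 a‖ₑ ^ q * σ x ≤
        (2 * 2 ^ n * β) ^ q * ((∑ j ∈ Finset.range (k + 1),
          (S j).indicator (fun y => ⨍⁻ z in D.cell j y, W z ∂volume) x) ^ q * σ x) := by
      intro x hx
      rw [← mul_assoc, ← ENNReal.mul_rpow_of_nonneg _ _ hq0]
      refine mul_le_mul_left (ENNReal.rpow_le_rpow ?_ hq0) _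
      rw [← D.isLevel_mean volume b 0 x a hx]
      refine (D.enorm_mean_sub_mean_zero_le hd1 hdt hvol0 hvolt hvold hbint k x).trans ?_
      rw [mul_assoc (2 * 2 ^ n), Finset.mul_sum (a := β)]
      refine mul_le_mul_right (Finset.sum_le_sum fun j _ => ?_) _
      by_cases hj : x ∈ S j
      · rw [Set.indicator_of_mem hj, Set.indicator_of_mem hj]
        exact hdev j x
      · rw [Set.indicator_of_notMem hj]
        exact zero_le
    have hFm : Measurable fun x => ∑ j ∈ Finset.range (k + 1),
        (S j).indicator (fun y => ⨍⁻ z in D.cell j y, W z ∂volume) x :=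
      Finset.measurable_fun_sum _ fun j _ =>
        (D.isLevel_of_cell j fun s => ⨍⁻ z in s, W z ∂volume).measurable.indicator
          (hSlevel j).measurableSet
    calc _ ≤ ∫⁻ x in D.cell 0 a, (2 * 2 ^ n * β) ^ q * ((∑ j ∈ Finset.range (k + 1),
          (S j).indicator (fun y => ⨍⁻ z in D.cell j y, W z ∂volume) x) ^ q * σ x) :=
          setLIntegral_mono' (D.measurableSet_cell 0 a) hpt
      _ = (2 * 2 ^ n * β) ^ q * ∫⁻ x in D.cell 0 a, (∑ j ∈ Finset.range (k + 1),
          (S j).indicator (fun y => ⨍⁻ z in D.cell j y, W z ∂volume) x) ^ q * σ x :=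
          lintegral_const_mul'' _ ((hFm.pow_const q).aemeasurable.mul hσm.restrict)
      _ ≤ (2 * 2 ^ n * β) ^ q * ((ENNReal.ofReal q *
          (2 ^ (p + q) * K ^ max 1 (1 / (p - 1)))) ^ q * ∫⁻ x in D.cell 0 a, W x) :=
          mul_le_mul_right (hsparse (k + 1)) _
      _ = _ := by
          rw [← mul_assoc, ← ENNReal.mul_rpow_of_nonneg _ _ hq0,
            setLIntegral_congr (dyadicGrid_cell_zero_ae_eq a hl), wMass]
          congr 2
          ring
  have hmean0 : D.mean volume b 0 a = ⨍ y in cube a l, b y :=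
    setAverage_congr (dyadicGrid_cell_zero_ae_eq a hl)
  rw [← setLIntegral_congr (dyadicGrid_cell_zero_ae_eq a hl), ← hmean0]
  have hlim : ∀ᵐ x ∂volume.restrict (D.cell 0 a),
      ‖b x - D.mean volume b 0 a‖ₑ ^ q * σ x = Filter.liminf (fun k =>
        ‖D.mean volume b k x - D.mean volume b 0 a‖ₑ ^ q * σ x) Filter.atTop := by
    filter_upwards [ae_restrict_of_ae (ae_tendsto_mean_dyadicGrid a hl hb),
      ae_restrict_of_ae hw.dual_ne_top] with x hx hσx
    refine (Filter.Tendsto.liminf_eq ?_).symm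
    -- Finiteness of `σ x` covers the case where the limit of the first factor is `0`.
    refine ENNReal.Tendsto.mul_const ?_ (Or.inr hσx)
    exact (ENNReal.continuous_rpow_const.tendsto _).comp ((hx.sub_const _).enorm)
  rw [lintegral_congr_ae hlim]
  refine (lintegral_liminf_le' fun k => ?_).trans ?_
  · exact (((((D.isLevel_mean volume b k).measurable).sub_const _).enorm.pow_const
      q).aemeasurable).mul hσm.restrict
  · exact Filter.liminf_le_of_frequently_le' (Filter.Frequently.of_forall hmeanLe)

/-! ### Comparison of exponents and conclusion. -/

/-- The normalized `L^r` means in the definition of `BMO_{w,r}` increase with `r`. -/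
lemma lintegral_rpow_mul_div_le {X : Type*} [MeasurableSpace X] {ν : Measure X}
    {f W : X → ℝ≥0∞} (hf : AEMeasurable f ν) (hW : AEMeasurable W ν)
    (h0 : ∀ᵐ x ∂ν, W x ≠ 0) (htop : ∀ᵐ x ∂ν, W x ≠ ∞)
    (hW0 : ∫⁻ x, W x ∂ν ≠ 0) (hWtop : ∫⁻ x, W x ∂ν ≠ ∞) {r s : ℝ} (hr : 0 < r) (hrs : r ≤ s) :
    (∫⁻ x, f x ^ r * W x ^ (1 - r) ∂ν) / ∫⁻ x, W x ∂ν ≤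
      ((∫⁻ x, f x ^ s * W x ^ (1 - s) ∂ν) / ∫⁻ x, W x ∂ν) ^ (r / s) := by
  have hs : 0 < s := hr.trans_le hrs
  have hrs0 : 0 ≤ r / s := by positivity
  have hrs1 : r / s ≤ 1 := (div_le_one hs).2 hrs
  set M := ∫⁻ x, W x ∂ν with hM
  -- Since `f ^ r * W ^ (1-r) = (f / W) ^ r * W`, this is Jensen's inequality for the measure with
  -- density `W`, written as Hölder's inequality between `f ^ s * W ^ (1-s)` and `W`.
  have hH := ENNReal.lintegral_mul_norm_pow_le (μ := ν) (p := r / s) (q := 1 - r / s)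
    ((hf.pow_const s).mul (hW.pow_const (1 - s))) hW hrs0 (by linarith) (by ring)
  have hint : ∫⁻ x, f x ^ r * W x ^ (1 - r) ∂ν =
      ∫⁻ x, (f x ^ s * W x ^ (1 - s)) ^ (r / s) * W x ^ (1 - r / s) ∂ν := by
    refine lintegral_congr_ae ?_
    filter_upwards [h0, htop] with x h0 ht
    rw [ENNReal.mul_rpow_of_nonneg _ _ hrs0, ← ENNReal.rpow_mul, ← ENNReal.rpow_mul, mul_assoc,
      ← ENNReal.rpow_add _ _ h0 ht, mul_div_cancel₀ _ hs.ne']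
    congr 2
    field_simp
    ring
  rw [hint, ENNReal.div_rpow_of_nonneg _ _ hrs0]
  refine ENNReal.div_le_of_le_mul (hH.trans_eq ?_)
  rw [ENNReal.rpow_sub _ _ hW0 hWtop, ENNReal.rpow_one]
  simp only [div_eq_mul_inv, Pi.mul_apply]
  ring

end WeightedBMO

theorem theorem4p2 (n : ℕ) (hn : 1 ≤ n) (p : ℝ) (hp : 1 < p) (r : ℝ) (hr : 1 ≤ r)
    (hrp : r ≤ Real.conjExponent p) :
    ∃ C : ℝ≥0, 0 < C ∧
      ∀ (w : (Fin n → ℝ) → ℝ), WeightedBMO.IsApWeight p w →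
      ∀ (b : (Fin n → ℝ) → ℂ), WeightedBMO.MemBMO w b →
        WeightedBMO.bmoNorm w b ≤ WeightedBMO.bmoNormR w r b ∧
        WeightedBMO.bmoNormR w r b ≤
          (C : ℝ≥0∞) * WeightedBMO.apConst p w ^ (max 1 (1 / (p - 1))) *
            WeightedBMO.bmoNorm w b := by
  have hpq : p.HolderConjugate p.conjExponent := Real.HolderConjugate.conjExponent hp
  have hr0 : 0 < r := by linarith
  have hq0 : 0 < p.conjExponent := hpq.symm.pos
  set q := p.conjExponent with hq
  -- `2 * 2 ^ n` comes from sparse domination with dyadic doubling constant `2 ^ n`, `q` from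
  -- telescoping, and `2 ^ (p + q)` from the sparse pieces.
  refine ⟨2 * 2 ^ n * q.toNNReal * 2 ^ (p + q), ?_, fun w hw b hb => ?_⟩
  · have : 0 < q.toNNReal := Real.toNNReal_pos.2 hq0
    have : (0 : ℝ≥0) < 2 ^ (p + q) := NNReal.rpow_pos two_pos
    positivity
  have hmono : ∀ {s t : ℝ}, 0 < s → s ≤ t → ∀ (a : Fin n → ℝ) (l : ℝ), 0 < l →
      (∫⁻ x in WeightedBMO.cube a l, ‖b x - ⨍ y in WeightedBMO.cube a l, b y‖ₑ ^ s *
        ENNReal.ofReal (w x) ^ (1 - s)) / WeightedBMO.wMass w a l ≤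
      ((∫⁻ x in WeightedBMO.cube a l, ‖b x - ⨍ y in WeightedBMO.cube a l, b y‖ₑ ^ t *
        ENNReal.ofReal (w x) ^ (1 - t)) / WeightedBMO.wMass w a l) ^ (s / t) := by
    intro s t hs hst a l hl
    exact WeightedBMO.lintegral_rpow_mul_div_le
      (hb.locallyIntegrable.aestronglyMeasurable.aemeasurable.sub_const _).enorm.restrict
      hw.aemeasurable.restrict (ae_restrict_of_ae hw.ae_ne_zero)
      (Filter.Eventually.of_forall fun _ => ENNReal.ofReal_ne_top)
      (hw.wMass_ne_zero a hl) (hw.wMass_ne_top a l) hs hst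
  constructor
  · refine iSup_le fun a => iSup_le fun l => iSup_le fun hl => ?_
    -- At exponent `1` the weight factor is `w ^ 0 = 1`, which gives the unweighted integrand of
    -- `bmoNorm`.
    have h := hmono one_pos hr a l hl
    simp only [ENNReal.rpow_one, sub_self, ENNReal.rpow_zero, mul_one] at h
    refine h.trans (ENNReal.rpow_le_rpow ?_ (by positivity))
    exact le_iSup_of_le a (le_iSup_of_le l (le_iSup_of_le hl le_rfl))
  · rw [WeightedBMO.bmoNormR, one_div, ENNReal.rpow_inv_le_iff hr0]
    refine iSup_le fun a => iSup_le fun l => iSup_le fun hl => ?_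
    refine (hmono hr0 hrp a l hl).trans ?_
    have hexp : 1 - q = -(1 / (p - 1)) := by
      have : p - 1 ≠ 0 := by linarith
      rw [hq, Real.conjExponent]
      field_simp
      ring
    have hC : ((2 * 2 ^ n * q.toNNReal * 2 ^ (p + q) : ℝ≥0) : ℝ≥0∞) =
        2 * 2 ^ n * ENNReal.ofReal q * 2 ^ (p + q) := by
      rw [ENNReal.coe_mul, ENNReal.coe_rpow_of_ne_zero two_ne_zero]
      simp [ENNReal.ofReal]
    rw [hexp, hC]
    have hmain := ENNReal.div_le_of_le_mul
      (WeightedBMO.lintegral_enorm_sub_average_rpow_le hp hw hb.locallyIntegrable a hl)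
    refine (ENNReal.rpow_le_rpow hmain (by positivity)).trans_eq ?_
    rw [← ENNReal.rpow_mul, ← hq, mul_div_cancel₀ _ hq0.ne']
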